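/- An $\ell$-group is a group $L$ with a lattice order that is compatible with left and right multiplication. For $k\in\mathbb{N}$ let $T(k)$ be the set of group terms (built from $\cdot$, ${}^{-1}$, $e$) in $k$ variables. For $\ell$-group terms $u,v$ in these variables (built from $\wedge,\vee,\cdot,{}^{-1},e$), write $\mathsf{LG}\models u\le v$ if $u\le v$ holds in every $\ell$-group under every assignment of the variables. Let $k\in\mathbb{N}$, $n\ge 1$ and $t_1,\dots,t_n\in T(k)$, and consider the following two conditions: (1) $\mathsf{LG}\models e\le t_1\vee\cdots\vee t_n$; (2) for every $s\in T(k)$, $\mathsf{LG}\models e\le t_1\vee\cdots\vee t_n\vee s$ or $\mathsf{LG}\models e\le t_1\vee\cdots\vee t_n\vee s^{-1}$. Then (1) implies (2), and if $k\ne 1$ then (1) and (2) are equivalent. -/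

import Mathlib

universe u v

/-- The term algebra `T(X)` in the language `·, ⁻¹, e` of groups over the variables `X`. -/
inductive GroupTerm (X : Type v) : Type v
  | var (x : X) : GroupTerm X
  | one : GroupTerm X
  | mul (a b : GroupTerm X) : GroupTerm X
  | inv (a : GroupTerm X) : GroupTerm X

/-- The term algebra `T^ℓ(X)` in the language `∧, ∨, ·, ⁻¹, e` of lattice-ordered groups over
the variables `X`. -/
inductive LTerm (X : Type v) : Type v
  | var (x : X) : LTerm X
  | one : LTerm X
  | mul (a b : LTerm X) : LTerm X
  | inv (a : LTerm X) : LTerm X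
  | inf (a b : LTerm X) : LTerm X
  | sup (a b : LTerm X) : LTerm X

/-- A group term, regarded as an `ℓ`-group term. -/
def GroupTerm.toLTerm {X : Type v} : GroupTerm X → LTerm X
  | .var x => .var x
  | .one => .one
  | .mul a b => .mul a.toLTerm b.toLTerm
  | .inv a => .inv a.toLTerm

/-- The value of an `ℓ`-group term under an assignment of the variables; `t ↦ t.eval φ` is the
homomorphism from the term algebra to `L` that extends `φ`. -/
def LTerm.eval {X : Type v} {L : Type u} [Group L] [Lattice L] (φ : X → L) : LTerm X → L
  | .var x => φ x
  | .one => 1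
  | .mul a b => a.eval φ * b.eval φ
  | .inv a => (a.eval φ)⁻¹
  | .inf a b => a.eval φ ⊓ b.eval φ
  | .sup a b => a.eval φ ⊔ b.eval φ

/-- `LG ⊨ s ≈ t`: the equation `s ≈ t` is valid in every `ℓ`-group, that is, in every group with a
lattice order that is compatible with left and right multiplication. -/
def LGModelsEq {X : Type v} (s t : LTerm X) : Prop :=
  ∀ (L : Type u) [Group L] [Lattice L] [MulLeftMono L] [MulRightMono L] (φ : X → L),
    s.eval φ = t.eval φ

/-- `LG ⊨ s ≤ t`, where `s ≤ t` stands for the equation `s ∧ t ≈ s`. -/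
def LGModelsLE {X : Type v} (s t : LTerm X) : Prop :=
  LGModelsEq.{u} (LTerm.inf s t) s

/-- The term `t₀ ∨ … ∨ tₙ` (bracketed to the left), a join of `n + 1 ≥ 1` terms. -/
def LTerm.join {X : Type v} : {n : ℕ} → (Fin (n + 1) → LTerm X) → LTerm X
  | 0, t => t 0
  | _ + 1, t => LTerm.sup (LTerm.join fun i => t i.castSucc) (t (Fin.last _))

/-! Only (2) ⟹ (1) needs work. For `k = 0` the free group is trivial, so every `t i` evaluates to
`1`. For `k ≥ 2`, suppose (1) fails, witnessed by a join value `u` with `¬ 1 ≤ u`. A maximal filter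
submonoid avoiding `u` contains `x` or `x⁻¹` for every `x` (`exists_total_filterSubmonoid`). Pulled
back to the free group it gives a left-invariant total preorder, hence an action on `ℚ` in which
every `t i` moves one point `p` strictly down (`exists_hom_rat_of_total`).

These inequalities involve only finitely many points, the largest being `q`, so a generator may be
altered beyond `q` without disturbing them. A second generator carries `q` to such a point, where
the first can be made to move either way. A conjugate `s` of the first then satisfies `s p < p` in
one action and `s⁻¹ p < p` in another (`exists_undetermined`). As automorphisms of a chain form an
`ℓ`-group, both alternatives of (2) fail for `s`. -/

/-! ### Prime positive cones in lattice-ordered groups -/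

section Cone

variable {L : Type*} [Group L] [Lattice L]

/-- A submonoid that is also a lattice filter. -/
structure IsFilterSubmonoid (M : Set L) : Prop where
  one_mem : 1 ∈ M
  mul_mem : ∀ {x y}, x ∈ M → y ∈ M → x * y ∈ M
  inf_mem : ∀ {x y}, x ∈ M → y ∈ M → x ⊓ y ∈ M
  mem_of_le : ∀ {x y}, x ∈ M → x ≤ y → y ∈ M

theorem IsFilterSubmonoid.pow_mem {M : Set L} (hM : IsFilterSubmonoid M) {x : L} (hx : x ∈ M) :
    ∀ n : ℕ, x ^ n ∈ M
  | 0 => by simpa using hM.one_mem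
  | n + 1 => by
    rw [pow_succ]
    exact hM.mul_mem (hM.pow_mem hx n) hx

/-- The filter submonoid generated by `M` and `x`. -/
def filterAdjoin (M : Set L) (x : L) : Set L :=
  {y | ∃ m ∈ M, m ≤ 1 ∧ ∃ r : ℕ, (m ⊓ x) ^ r ≤ y}

theorem subset_filterAdjoin {M : Set L} (hM : IsFilterSubmonoid M) (x : L) :
    M ⊆ filterAdjoin M x := fun y hy =>
  ⟨y ⊓ 1, hM.inf_mem hy hM.one_mem, inf_le_right, 1, by
    rw [pow_one]
    exact inf_le_left.trans inf_le_left⟩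

theorem mem_filterAdjoin_self {M : Set L} (hM : IsFilterSubmonoid M) (x : L) :
    x ∈ filterAdjoin M x :=
  ⟨1, hM.one_mem, le_rfl, 1, by
    rw [pow_one]
    exact inf_le_right⟩

variable [MulLeftMono L] [MulRightMono L]

/-- Multiplication distributes over joins, so it suffices to scale `b` and `c` by the factor
carrying `b ⊔ c` to `a ⊓ (b ⊔ c)`. -/
theorem inf_sup_le_of_latticeGroup (a b c : L) : a ⊓ (b ⊔ c) ≤ a ⊓ b ⊔ a ⊓ c := by
  have key : ∀ x, x ≤ b ⊔ c → (a ⊓ (b ⊔ c)) * (b ⊔ c)⁻¹ * x ≤ a ⊓ x := by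
    intro x hx
    refine le_inf ?_ ?_
    · calc (a ⊓ (b ⊔ c)) * (b ⊔ c)⁻¹ * x ≤ a * (b ⊔ c)⁻¹ * (b ⊔ c) := by
            gcongr
            exact inf_le_left
        _ = a := by group
    · calc (a ⊓ (b ⊔ c)) * (b ⊔ c)⁻¹ * x ≤ (b ⊔ c) * (b ⊔ c)⁻¹ * x := by
            gcongr
            exact inf_le_right
        _ = x := by group
  calc a ⊓ (b ⊔ c) = (a ⊓ (b ⊔ c)) * (b ⊔ c)⁻¹ * (b ⊔ c) := by group
    _ = (a ⊓ (b ⊔ c)) * (b ⊔ c)⁻¹ * b ⊔ (a ⊓ (b ⊔ c)) * (b ⊔ c)⁻¹ * c := mul_sup _ _ _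
    _ ≤ a ⊓ b ⊔ a ⊓ c := sup_le_sup (key b le_sup_left) (key c le_sup_right)

/-- Pigeonhole: a word of length `i + j` in `a` and `b` has at least `i` letters `a` or at least `j`
letters `b`; deleting letters below `1` only increases it. -/
theorem sup_pow_add_le {a b : L} (ha : a ≤ 1) (hb : b ≤ 1) :
    ∀ i j : ℕ, (a ⊔ b) ^ (i + j) ≤ a ^ i ⊔ b ^ j
  | 0, j => by
    rw [pow_zero]
    exact (pow_le_one' (sup_le ha hb) _).trans le_sup_left
  | i + 1, 0 => by
    rw [pow_zero]
    exact (pow_le_one' (sup_le ha hb) _).trans le_sup_right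
  | i + 1, j + 1 => by
    have h₁ := sup_pow_add_le ha hb i (j + 1)
    have h₂ := sup_pow_add_le ha hb (i + 1) j
    calc (a ⊔ b) ^ (i + 1 + (j + 1))
        = a * (a ⊔ b) ^ (i + (j + 1)) ⊔ b * (a ⊔ b) ^ (i + 1 + j) := by
          rw [show i + 1 + (j + 1) = (i + 1 + j) + 1 by omega, pow_succ', sup_mul,
            show i + 1 + j = i + (j + 1) by omega]
      _ ≤ a * (a ^ i ⊔ b ^ (j + 1)) ⊔ b * (a ^ (i + 1) ⊔ b ^ j) := by gcongr
      _ ≤ a ^ (i + 1) ⊔ b ^ (j + 1) := by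
          rw [mul_sup, mul_sup, ← pow_succ', ← pow_succ']
          refine sup_le (sup_le le_sup_left ?_) (sup_le ?_ le_sup_right)
          · exact (mul_le_of_le_one_left' ha).trans le_sup_right
          · exact (mul_le_of_le_one_left' hb).trans le_sup_left

theorem isFilterSubmonoid_filterAdjoin {M : Set L} (hM : IsFilterSubmonoid M) (x : L) :
    IsFilterSubmonoid (filterAdjoin M x) where
  one_mem := subset_filterAdjoin hM x hM.one_mem
  mul_mem := by
    rintro y z ⟨m, hm, hm1, r, hr⟩ ⟨m', hm', -, r', hr'⟩
    refine ⟨m ⊓ m', hM.inf_mem hm hm', inf_le_left.trans hm1, r + r', ?_⟩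
    rw [pow_add]
    refine mul_le_mul' (le_trans ?_ hr) (le_trans ?_ hr')
    · exact pow_le_pow_left' (inf_le_inf_right _ inf_le_left) _
    · exact pow_le_pow_left' (inf_le_inf_right _ inf_le_right) _
  inf_mem := by
    rintro y z ⟨m, hm, hm1, r, hr⟩ ⟨m', hm', -, r', hr'⟩
    -- Below `1` powers decrease, so the exponent `r + r'` serves both bounds.
    have h1 : m ⊓ m' ⊓ x ≤ 1 := (inf_le_left.trans inf_le_left).trans hm1
    refine ⟨m ⊓ m', hM.inf_mem hm hm', inf_le_left.trans hm1, r + r', le_inf ?_ ?_⟩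
    · exact ((pow_le_pow_right_of_le_one' h1 (Nat.le_add_right _ _)).trans
        (pow_le_pow_left' (inf_le_inf_right _ inf_le_left) _)).trans hr
    · exact ((pow_le_pow_right_of_le_one' h1 (Nat.le_add_left _ _)).trans
        (pow_le_pow_left' (inf_le_inf_right _ inf_le_right) _)).trans hr'
  mem_of_le := by
    rintro y z ⟨m, hm, hm1, r, hr⟩ h
    exact ⟨m, hm, hm1, r, hr.trans h⟩

/-- Since `1 ≤ x ⊔ x⁻¹`, distributivity splits `m ⊓ m'` along `x` and `x⁻¹`, and `sup_pow_add_le`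
separates the powers. -/
theorem mem_of_mem_filterAdjoin_of_inv {M : Set L} (hM : IsFilterSubmonoid M) {x u : L}
    (h₁ : u ∈ filterAdjoin M x) (h₂ : u ∈ filterAdjoin M x⁻¹) : u ∈ M := by
  obtain ⟨m, hm, hm1, r, hr⟩ := h₁
  obtain ⟨m', hm', -, r', hr'⟩ := h₂
  have hc : m ⊓ m' ≤ 1 := inf_le_left.trans hm1
  have hle : m ⊓ m' ≤ (m ⊓ m' ⊓ x) ⊔ (m ⊓ m' ⊓ x⁻¹) :=
    (le_inf le_rfl (hc.trans (one_le_mabs x))).trans (inf_sup_le_of_latticeGroup _ _ _)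
  refine hM.mem_of_le (hM.pow_mem (hM.inf_mem hm hm') (r + r')) ?_
  calc (m ⊓ m') ^ (r + r') ≤ ((m ⊓ m' ⊓ x) ⊔ (m ⊓ m' ⊓ x⁻¹)) ^ (r + r') := pow_le_pow_left' hle _
    _ ≤ (m ⊓ m' ⊓ x) ^ r ⊔ (m ⊓ m' ⊓ x⁻¹) ^ r' :=
        sup_pow_add_le (inf_le_left.trans hc) (inf_le_left.trans hc) _ _
    _ ≤ (m ⊓ x) ^ r ⊔ (m' ⊓ x⁻¹) ^ r' :=
        sup_le_sup (pow_le_pow_left' (inf_le_inf_right _ inf_le_left) _)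
          (pow_le_pow_left' (inf_le_inf_right _ inf_le_right) _)
    _ ≤ u := sup_le hr hr'

theorem exists_total_filterSubmonoid {u : L} (hu : ¬ 1 ≤ u) :
    ∃ M : Set L, IsFilterSubmonoid M ∧ u ∉ M ∧ ∀ x, x ∈ M ∨ x⁻¹ ∈ M := by
  obtain ⟨M, -, hM⟩ := zorn_subset_nonempty {M : Set L | IsFilterSubmonoid M ∧ u ∉ M}
    (fun c hc hchain hne => by
      refine ⟨⋃₀ c, ⟨?_, ?_⟩, fun s hs => Set.subset_sUnion_of_mem hs⟩
      · have two : ∀ {x y}, x ∈ ⋃₀ c → y ∈ ⋃₀ c → ∃ s ∈ c, x ∈ s ∧ y ∈ s := by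
          rintro x y ⟨s, hs, hxs⟩ ⟨t, ht, hyt⟩
          rcases hchain.total hs ht with h | h
          · exact ⟨t, ht, h hxs, hyt⟩
          · exact ⟨s, hs, hxs, h hyt⟩
        constructor
        · obtain ⟨s, hs⟩ := hne
          exact ⟨s, hs, (hc hs).1.one_mem⟩
        · intro x y hx hy
          obtain ⟨s, hs, h1, h2⟩ := two hx hy
          exact ⟨s, hs, (hc hs).1.mul_mem h1 h2⟩
        · intro x y hx hy
          obtain ⟨s, hs, h1, h2⟩ := two hx hy
          exact ⟨s, hs, (hc hs).1.inf_mem h1 h2⟩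
        · rintro x y ⟨s, hs, hx⟩ hxy
          exact ⟨s, hs, (hc hs).1.mem_of_le hx hxy⟩
      · rintro ⟨s, hs, hus⟩
        exact (hc hs).2 hus) (Set.Ici 1)
    ⟨⟨le_rfl, fun hx hy => one_le_mul hx hy, fun hx hy => le_inf hx hy,
      fun hx h => le_trans hx h⟩, hu⟩
  refine ⟨M, hM.prop.1, hM.prop.2, fun x => ?_⟩
  by_contra! h
  have key : ∀ z, z ∉ M → u ∈ filterAdjoin M z := fun z hz => by
    by_contra hn
    exact hz (hM.le_of_ge ⟨isFilterSubmonoid_filterAdjoin hM.prop.1 z, hn⟩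
      (subset_filterAdjoin hM.prop.1 z) (mem_filterAdjoin_self hM.prop.1 z))
  exact hM.prop.2 (mem_of_mem_filterAdjoin_of_inv hM.prop.1 (key x h.1) (key _ h.2))

end Cone

/-! ### Actions on the rational line -/

/-- Conjugation by an order isomorphism. -/
def OrderIso.conjHom {α β : Type*} [LE α] [LE β] (e : α ≃o β) : (α ≃o α) →* (β ≃o β) where
  toFun f := (e.symm.trans f).trans e
  map_one' := by
    ext x
    simp
  map_mul' f g := by
    ext x
    simp

@[simp]
theorem OrderIso.conjHom_apply {α β : Type*} [LE α] [LE β] (e : α ≃o β) (f : α ≃o α) (x : β) :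
    e.conjHom f x = e (f (e.symm x)) := rfl

/-- The lexicographic product with `ℚ`, acted on through the first coordinate, is countable, dense
and without endpoints, so Cantor's theorem identifies it with `ℚ`. -/
theorem exists_hom_rat_of_countable {G C : Type*} [Group G] [LinearOrder C] [Countable C]
    [MulAction G C] (hmono : ∀ g : G, Monotone fun c : C => g • c) (c : C) :
    ∃ (ρ : G →* (ℚ ≃o ℚ)) (p : ℚ), ∀ g : G, g • c < c → ρ g p < p := by
  have hne : Nonempty (C ×ₗ ℚ) := ⟨toLex (c, 0)⟩
  have hcount : Countable (C ×ₗ ℚ) := inferInstanceAs (Countable (C × ℚ))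
  obtain ⟨e⟩ := Order.iso_of_countable_dense (C ×ₗ ℚ) ℚ
  let act : G →* (C ≃o C) :=
    { toFun := fun g => (MulAction.toPerm g).toOrderIso (hmono g) (by
        intro a b h
        simpa using hmono g⁻¹ h)
      map_one' := by
        ext x
        exact one_smul G x
      map_mul' := fun g h => by
        ext x
        exact mul_smul g h x }
  let lex : (C ≃o C) →* (C ×ₗ ℚ ≃o C ×ₗ ℚ) :=
    { toFun := fun f => Prod.Lex.prodLexCongr f (OrderIso.refl ℚ)
      map_one' := by
        ext x
        rfl
      map_mul' := fun g h => by
        ext x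
        rfl }
  refine ⟨e.conjHom.comp (lex.comp act), e (toLex (c, 0)), fun g hg => ?_⟩
  have : (lex (act g)) (toLex (c, 0)) < toLex (c, 0) := by
    rw [Prod.Lex.lt_iff]
    exact Or.inl hg
  simpa using this

theorem exists_hom_rat_of_total {G : Type*} [Group G] [Countable G] (P : Set G) (h1 : 1 ∈ P)
    (hmul : ∀ x ∈ P, ∀ y ∈ P, x * y ∈ P) (htot : ∀ x, x ∈ P ∨ x⁻¹ ∈ P) :
    ∃ (ρ : G →* (ℚ ≃o ℚ)) (p : ℚ), ∀ g : G, g ∉ P → ρ g p < p := by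
  classical
  let : Preorder G :=
    { le := fun x y => x⁻¹ * y ∈ P
      le_refl := fun x => by simpa using h1
      le_trans := fun x y z hxy hyz => by
        simpa [mul_assoc] using hmul _ hxy _ hyz }
  have hle : ∀ x y : G, x ≤ y ↔ x⁻¹ * y ∈ P := fun _ _ => Iff.rfl
  have : @Std.Total G (· ≤ ·) := ⟨fun x y => by
    simpa [hle] using htot (x⁻¹ * y)⟩
  -- `P` may contain both `x` and `x⁻¹`, so a quotient is needed to get a chain.
  let C := Antisymmetrization G (· ≤ ·)
  have hmono : ∀ g : G, Monotone fun x : G => g * x := fun g x y hxy => by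
    simpa [hle, mul_assoc] using hxy
  let : MulAction G C :=
    { smul := fun g => OrderHom.antisymmetrization ⟨fun x => g * x, hmono g⟩
      one_smul := by
        rintro ⟨x⟩
        exact congrArg (toAntisymmetrization (· ≤ ·)) (one_mul x)
      mul_smul := by
        rintro g h ⟨x⟩
        exact congrArg (toAntisymmetrization (· ≤ ·)) (mul_assoc g h x) }
  have : Countable C := inferInstanceAs (Countable (Quotient _))
  obtain ⟨ρ, p, h⟩ := exists_hom_rat_of_countable (G := G) (C := C)
    (fun g => (OrderHom.antisymmetrization ⟨fun x => g * x, hmono g⟩).monotone)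
    (toAntisymmetrization (· ≤ ·) 1)
  refine ⟨ρ, p, fun g hg => h g ?_⟩
  change toAntisymmetrization (· ≤ ·) (g * 1) < toAntisymmetrization (· ≤ ·) 1
  rw [toAntisymmetrization_lt_toAntisymmetrization_iff, mul_one, lt_iff_le_not_ge]
  have hng : ¬ (1 : G) ≤ g := by simpa [hle] using hg
  exact ⟨(Std.Total.total (r := (· ≤ ·)) (1 : G) g).resolve_left hng, hng⟩

/-! ### Perturbing order automorphisms of the rational line -/

/-- Replace an order automorphism `f` with `f q ≤ q` by the line of slope `l` beyond `q`. -/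
def affineBeyond (f : ℚ ≃o ℚ) (q l : ℚ) (hl : 0 < l) : ℚ ≃o ℚ :=
  StrictMono.orderIsoOfRightInverse (fun x => if x ≤ q then f x else f q + l * (x - q))
    (fun x y hxy => by
      dsimp only
      split_ifs with hx hy hy
      · exact f.strictMono hxy
      · have : f x ≤ f q := f.monotone hx
        have : 0 < l * (y - q) := mul_pos hl (by linarith)
        linarith
      · exact absurd (hxy.le.trans hy) hx
      · have : l * (x - q) < l * (y - q) := mul_lt_mul_of_pos_left (by linarith) hl
        linarith)
    (fun y => if y ≤ f q then f.symm y else q + (y - f q) / l)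
    (fun y => by
      dsimp only
      by_cases hy : y ≤ f q
      · rw [if_pos hy, if_pos ((f.symm_apply_le).2 hy), f.apply_symm_apply]
      · have : 0 < (y - f q) / l := div_pos (by linarith) hl
        rw [if_neg hy, if_neg (by linarith)]
        field_simp
        ring)

theorem affineBeyond_of_le (f : ℚ ≃o ℚ) {q l x : ℚ} (hl : 0 < l) (hx : x ≤ q) :
    affineBeyond f q l hl x = f x := if_pos hx

theorem affineBeyond_of_lt (f : ℚ ≃o ℚ) {q l x : ℚ} (hl : 0 < l) (hx : q < x) :
    affineBeyond f q l hl x = f q + l * (x - q) := if_neg hx.not_ge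

/-- `f'` agrees with `f` as a partial automorphism of the ray `(-∞, q]`. -/
def AgreeUpTo (q : ℚ) (f f' : ℚ ≃o ℚ) : Prop := ∀ x ≤ q, f x ≤ q → f' x = f x

theorem AgreeUpTo.inv {q : ℚ} {f f' : ℚ ≃o ℚ} (h : AgreeUpTo q f f') : AgreeUpTo q f⁻¹ f'⁻¹ := by
  intro x hx hfx
  have h' : f' (f⁻¹ x) = x := by
    rw [h _ hfx (by rwa [RelIso.apply_inv_self]), RelIso.apply_inv_self]
  calc f'⁻¹ x = f'⁻¹ (f' (f⁻¹ x)) := by rw [h']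
    _ = f⁻¹ x := RelIso.inv_apply_self _ _

theorem exists_agreeUpTo_of_le (f : ℚ ≃o ℚ) {q q' : ℚ} (hq : q < q') (hf : f q ≤ q) :
    (∃ f', AgreeUpTo q f f' ∧ f' q' < q') ∧ ∃ f', AgreeUpTo q f f' ∧ q' < f' q' := by
  have hpos : 0 < q' - q := by linarith
  -- Slope `1 / 2` keeps the value at `q'` below `q'`; the second slope makes it `q' + 1`.
  refine ⟨⟨affineBeyond f q (1 / 2) (by norm_num), fun x hx _ => affineBeyond_of_le f _ hx, ?_⟩,
    ⟨affineBeyond f q ((q' - f q + 1) / (q' - q)) (div_pos (by linarith) hpos),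
      fun x hx _ => affineBeyond_of_le f _ hx, ?_⟩⟩
  · rw [affineBeyond_of_lt f _ hq]
    linarith
  · rw [affineBeyond_of_lt f _ hq, div_mul_cancel₀ _ hpos.ne']
    linarith

theorem inv_apply_lt_iff (f : ℚ ≃o ℚ) (x : ℚ) : f⁻¹ x < x ↔ x < f x := by
  conv_rhs => rw [← f⁻¹.lt_iff_lt]
  rw [RelIso.inv_apply_self]

theorem lt_inv_apply_iff (f : ℚ ≃o ℚ) (x : ℚ) : x < f⁻¹ x ↔ f x < x := by
  simpa using (inv_apply_lt_iff f⁻¹ x).symm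

theorem exists_agreeUpTo (f : ℚ ≃o ℚ) {q q' : ℚ} (hq : q < q') :
    (∃ f', AgreeUpTo q f f' ∧ f' q' < q') ∧ ∃ f', AgreeUpTo q f f' ∧ q' < f' q' := by
  rcases le_total (f q) q with hf | hf
  · exact exists_agreeUpTo_of_le f hq hf
  · have hf' : f⁻¹ q ≤ q := by
      rw [← f.le_iff_le, RelIso.apply_inv_self]
      exact hf
    obtain ⟨⟨g, hg, hgq⟩, ⟨g', hg', hgq'⟩⟩ := exists_agreeUpTo_of_le f⁻¹ hq hf'
    refine ⟨⟨g'⁻¹, by simpa using hg'.inv, (inv_apply_lt_iff _ _).2 hgq'⟩,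
      ⟨g⁻¹, by simpa using hg.inv, (lt_inv_apply_iff _ _).2 hgq⟩⟩

theorem lift_mk_cons_apply {ι : Type*} (f : ι → (ℚ ≃o ℚ)) (i : ι) (b : Bool)
    (L : List (ι × Bool)) (p : ℚ) :
    FreeGroup.lift f (FreeGroup.mk ((i, b) :: L)) p =
      (cond b (f i) (f i)⁻¹) (FreeGroup.lift f (FreeGroup.mk L) p) := by
  simp only [FreeGroup.lift_mk, List.map_cons, List.prod_cons, RelIso.mul_apply]

/-- Letters act from the right, so the points visited are the images of `p` under suffixes. -/
theorem lift_mk_apply_eq_of_agreeUpTo {ι : Type*} {f f' : ι → (ℚ ≃o ℚ)} {p q : ℚ}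
    (h : ∀ i, AgreeUpTo q (f i) (f' i)) :
    ∀ L : List (ι × Bool), (∀ L', L' <:+ L → FreeGroup.lift f (FreeGroup.mk L') p ≤ q) →
      FreeGroup.lift f' (FreeGroup.mk L) p = FreeGroup.lift f (FreeGroup.mk L) p
  | [], _ => by simp [FreeGroup.lift_mk]
  | (i, b) :: L, hL => by
    have ih := lift_mk_apply_eq_of_agreeUpTo h L
      fun L' hL' => hL L' (hL'.trans (List.suffix_cons _ _))
    have h1 := hL L (List.suffix_cons _ _)
    have h2 := hL _ List.suffix_rfl
    rw [lift_mk_cons_apply] at h2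
    rw [lift_mk_cons_apply, lift_mk_cons_apply, ih]
    cases b
    · exact (h i).inv _ h1 h2
    · exact h i _ h1 h2

/-- In a free group of rank at least two, finitely many negativity conditions never determine
the sign of every element. -/
theorem exists_undetermined {ι κ : Type*} [Nontrivial ι] [Finite κ] [Nonempty κ]
    (w : κ → FreeGroup ι) (f : ι → (ℚ ≃o ℚ)) (p : ℚ) (hw : ∀ c, FreeGroup.lift f (w c) p < p) :
    ∃ s : FreeGroup ι,
      (∃ f' : ι → (ℚ ≃o ℚ), (∀ c, FreeGroup.lift f' (w c) p < p) ∧ FreeGroup.lift f' s p < p) ∧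
      ∃ f' : ι → (ℚ ≃o ℚ), (∀ c, FreeGroup.lift f' (w c) p < p) ∧
        FreeGroup.lift f' s⁻¹ p < p := by
  classical
  let S : Set (List (ι × Bool)) := ⋃ c, {L | L <:+ (w c).toWord}
  have hS : S.Finite := Set.finite_iUnion fun c =>
    (List.finite_toSet (w c).toWord.tails).subset fun L hL => (List.mem_tails _ _).2 hL
  obtain ⟨c₀⟩ := ‹Nonempty κ›
  obtain ⟨W, hWS, hmax⟩ := Set.exists_max_image S
    (fun L => FreeGroup.lift f (FreeGroup.mk L) p) hS
    ⟨[], Set.mem_iUnion.2 ⟨c₀, List.nil_suffix⟩⟩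
  set q := FreeGroup.lift f (FreeGroup.mk W) p with hq
  have hagree : ∀ f' : ι → (ℚ ≃o ℚ), (∀ i, AgreeUpTo q (f i) (f' i)) → ∀ L ∈ S,
      FreeGroup.lift f' (FreeGroup.mk L) p = FreeGroup.lift f (FreeGroup.mk L) p := by
    intro f' hf' L hL
    refine lift_mk_apply_eq_of_agreeUpTo hf' L fun L' hL' => hmax L' ?_
    obtain ⟨c, hc⟩ := Set.mem_iUnion.1 hL
    exact Set.mem_iUnion.2 ⟨c, hL'.trans hc⟩
  -- Otherwise the whole group fixes `q`, forcing `q = p` and contradicting `hw`.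
  obtain ⟨i, hi⟩ : ∃ i, f i q ≠ q := by
    by_contra! hfix
    have hall : ∀ g : FreeGroup ι, FreeGroup.lift f g q = q := by
      intro g
      induction g using FreeGroup.induction_on with
      | C1 => simp
      | of i => simpa using hfix i
      | inv_of i _ =>
        rw [map_inv, FreeGroup.lift_apply_of]
        conv_lhs => rw [← hfix i]
        exact RelIso.inv_apply_self _ _
      | mul x y hx hy => rw [map_mul, RelIso.mul_apply, hy, hx]
    have hpq : q = p := (FreeGroup.lift f (FreeGroup.mk W)).injective (hall _)
    exact (hw c₀).ne (by rw [← hpq]; exact hall _)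
  obtain ⟨j, hji⟩ := exists_ne i
  -- `a` is the generator `i` or its inverse, untouched by changes at `j`.
  obtain ⟨a, haq, ha⟩ : ∃ a : FreeGroup ι, q < FreeGroup.lift f a q ∧
      ∀ g, FreeGroup.lift (Function.update f j g) a = FreeGroup.lift f a := by
    rcases hi.lt_or_gt with h | h
    · refine ⟨(FreeGroup.of i)⁻¹, ?_, fun g => ?_⟩
      · simpa using (lt_inv_apply_iff _ _).2 h
      · simp [Function.update_of_ne hji.symm]
    · refine ⟨FreeGroup.of i, by simpa using h, fun g => ?_⟩
      simp [Function.update_of_ne hji.symm]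
  have key : ∀ g, AgreeUpTo q (f j) g →
      (∀ c, FreeGroup.lift (Function.update f j g) (w c) p < p) ∧
      FreeGroup.lift (Function.update f j g) (a * FreeGroup.mk W) p = FreeGroup.lift f a q := by
    intro g hg
    have hup : ∀ i', AgreeUpTo q (f i') (Function.update f j g i') := by
      intro i'
      rcases eq_or_ne i' j with rfl | hne
      · simpa using hg
      · rw [Function.update_of_ne hne]
        exact fun _ _ _ => rfl
    refine ⟨fun c => ?_, ?_⟩
    · have := hagree _ hup (w c).toWord (Set.mem_iUnion.2 ⟨c, List.suffix_rfl⟩)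
      rw [FreeGroup.mk_toWord] at this
      rw [this]
      exact hw c
    · rw [map_mul, RelIso.mul_apply, hagree _ hup W hWS, ha]
  have conj : ∀ (φ : FreeGroup ι →* (ℚ ≃o ℚ)) (h b : FreeGroup ι),
      φ b (φ h p) < φ h p → φ (h⁻¹ * b * h) p < p := by
    intro φ h b hb
    rw [← (φ h).lt_iff_lt, ← RelIso.mul_apply, ← map_mul]
    simpa [mul_assoc] using hb
  obtain ⟨⟨g, hg, hgq⟩, ⟨g', hg', hgq'⟩⟩ := exists_agreeUpTo (f j) haq
  -- Conjugation moves the comparison from `p` to `a q > q`, where the generator `j` is free.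
  refine ⟨(a * FreeGroup.mk W)⁻¹ * FreeGroup.of j * (a * FreeGroup.mk W),
    ⟨Function.update f j g, (key g hg).1, conj _ _ _ ?_⟩,
    ⟨Function.update f j g', (key g' hg').1, ?_⟩⟩
  · rw [(key g hg).2]
    simpa using hgq
  · rw [show ((a * FreeGroup.mk W)⁻¹ * FreeGroup.of j * (a * FreeGroup.mk W))⁻¹ =
      (a * FreeGroup.mk W)⁻¹ * (FreeGroup.of j)⁻¹ * (a * FreeGroup.mk W) by group]
    apply conj
    rw [(key g' hg').2]
    simpa using (inv_apply_lt_iff _ _).2 hgq'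

/-! ### The lattice-ordered group of automorphisms of a chain -/

section Aut

variable {α : Type*} [LinearOrder α]

instance : PartialOrder (α ≃o α) :=
  PartialOrder.lift (fun f : α ≃o α => (f : α → α)) DFunLike.coe_injective

/-- The pointwise maximum of two automorphisms of a chain. -/
def OrderIso.pointwiseSup (f g : α ≃o α) : α ≃o α :=
  StrictMono.orderIsoOfRightInverse (fun x => f x ⊔ g x)
    (fun _ _ h => max_lt_max (f.strictMono h) (g.strictMono h))
    (fun x => f.symm x ⊓ g.symm x)
    (fun x => by
      dsimp only
      rcases le_total (f.symm x) (g.symm x) with h | h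
      · rw [inf_eq_left.2 h, f.apply_symm_apply, sup_eq_left]
        exact (g.le_symm_apply).1 h
      · rw [inf_eq_right.2 h, g.apply_symm_apply, sup_eq_right]
        exact (f.le_symm_apply).1 h)

/-- The pointwise minimum of two automorphisms of a chain. -/
def OrderIso.pointwiseInf (f g : α ≃o α) : α ≃o α :=
  StrictMono.orderIsoOfRightInverse (fun x => f x ⊓ g x)
    (fun _ _ h => min_lt_min (f.strictMono h) (g.strictMono h))
    (fun x => f.symm x ⊔ g.symm x)
    (fun x => by
      dsimp only
      rcases le_total (f.symm x) (g.symm x) with h | h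
      · rw [sup_eq_right.2 h, g.apply_symm_apply, inf_eq_right]
        exact (f.symm_apply_le).1 h
      · rw [sup_eq_left.2 h, f.apply_symm_apply, inf_eq_left]
        exact (g.symm_apply_le).1 h)

instance : Lattice (α ≃o α) where
  sup := OrderIso.pointwiseSup
  inf := OrderIso.pointwiseInf
  le_sup_left _ _ _ := le_sup_left
  le_sup_right _ _ _ := le_sup_right
  sup_le _ _ _ h₁ h₂ x := sup_le (h₁ x) (h₂ x)
  inf_le_left _ _ _ := inf_le_left
  inf_le_right _ _ _ := inf_le_right
  le_inf _ _ _ h₁ h₂ x := le_inf (h₁ x) (h₂ x)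

instance : MulLeftMono (α ≃o α) := ⟨fun f _ _ h x => f.monotone (h x)⟩

instance : MulRightMono (α ≃o α) := ⟨fun f _ _ h x => h (f x)⟩

end Aut

/-! ### Terms -/

/-- The element of the free group denoted by a group term. -/
def GroupTerm.toFreeGroup {X : Type v} : GroupTerm X → FreeGroup X
  | .var x => .of x
  | .one => 1
  | .mul a b => a.toFreeGroup * b.toFreeGroup
  | .inv a => a.toFreeGroup⁻¹

theorem GroupTerm.toFreeGroup_surjective {X : Type v} :
    Function.Surjective (GroupTerm.toFreeGroup (X := X)) := by
  intro g
  induction g using FreeGroup.induction_on with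
  | C1 => exact ⟨.one, rfl⟩
  | of x => exact ⟨.var x, rfl⟩
  | inv_of x _ => exact ⟨.inv (.var x), rfl⟩
  | mul x y hx hy =>
    obtain ⟨a, rfl⟩ := hx
    obtain ⟨b, rfl⟩ := hy
    exact ⟨.mul a b, rfl⟩

theorem GroupTerm.eval_toLTerm {X : Type v} {L : Type u} [Group L] [Lattice L] (φ : X → L)
    (t : GroupTerm X) : t.toLTerm.eval φ = FreeGroup.lift φ t.toFreeGroup := by
  induction t with
  | var x => simp [GroupTerm.toLTerm, GroupTerm.toFreeGroup, LTerm.eval]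
  | one => simp [GroupTerm.toLTerm, GroupTerm.toFreeGroup, LTerm.eval]
  | mul a b ha hb => simp [GroupTerm.toLTerm, GroupTerm.toFreeGroup, LTerm.eval, ha, hb]
  | inv a ha => simp [GroupTerm.toLTerm, GroupTerm.toFreeGroup, LTerm.eval, ha]

theorem LTerm.eval_le_eval_join {X : Type v} {L : Type u} [Group L] [Lattice L] (φ : X → L) :
    ∀ {n : ℕ} (t : Fin (n + 1) → LTerm X) (i : Fin (n + 1)), (t i).eval φ ≤ (join t).eval φ
  | 0, t, i => by
    obtain rfl : i = 0 := Fin.eq_zero i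
    exact le_rfl
  | n + 1, t, i => by
    refine Fin.lastCases ?_ (fun i => ?_) i
    · exact le_sup_right
    · exact (eval_le_eval_join φ (fun i => t i.castSucc) i).trans le_sup_left

theorem LTerm.eval_join_apply_lt {X : Type v} {α : Type u} [LinearOrder α] (φ : X → (α ≃o α))
    (p : α) : ∀ {n : ℕ} (t : Fin (n + 1) → LTerm X), (∀ i, (t i).eval φ p < p) →
      (join t).eval φ p < p
  | 0, _, h => h 0
  | _ + 1, t, h =>
    max_lt (eval_join_apply_lt φ p (fun i => t i.castSucc) fun i => h i.castSucc) (h (Fin.last _))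

theorem lgModelsLE_one_iff {X : Type v} (t : LTerm X) :
    LGModelsLE.{u} LTerm.one t ↔
      ∀ (L : Type u) [Group L] [Lattice L] [MulLeftMono L] [MulRightMono L] (φ : X → L),
        1 ≤ t.eval φ := by
  simp only [LGModelsLE, LGModelsEq, LTerm.eval, inf_eq_left]

theorem exists_rat_of_not_lgModelsLE {X : Type v} [Countable X] {n : ℕ}
    (t : Fin (n + 1) → GroupTerm X)
    (h : ¬ LGModelsLE.{u} LTerm.one (LTerm.join fun i => (t i).toLTerm)) :
    ∃ (f : X → (ℚ ≃o ℚ)) (p : ℚ), ∀ i, FreeGroup.lift f (t i).toFreeGroup p < p := by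
  rw [lgModelsLE_one_iff] at h
  push Not at h
  obtain ⟨L, _, _, _, _, φ, hφ⟩ := h
  obtain ⟨M, hM, hu, htot⟩ := exists_total_filterSubmonoid hφ
  obtain ⟨ρ, p, hρ⟩ := exists_hom_rat_of_total (FreeGroup.lift φ ⁻¹' M)
    (by simpa using hM.one_mem) (fun x hx y hy => by simpa using hM.mul_mem hx hy)
    (fun x => by simpa using htot (FreeGroup.lift φ x))
  refine ⟨fun x => ρ (FreeGroup.of x), p, fun i => ?_⟩
  have hlift : FreeGroup.lift (fun x => ρ (FreeGroup.of x)) = ρ := by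
    ext x : 1
    simp
  rw [hlift]
  refine hρ _ fun hmem => hu (hM.mem_of_le hmem ?_)
  rw [← GroupTerm.eval_toLTerm]
  exact LTerm.eval_le_eval_join φ (fun i => (t i).toLTerm) i

theorem not_lgModelsLE_sup_of_rat {X : Type v} {n : ℕ} (t : Fin (n + 1) → GroupTerm X)
    (s : GroupTerm X) (f : X → (ℚ ≃o ℚ)) (p : ℚ)
    (ht : ∀ i, FreeGroup.lift f (t i).toFreeGroup p < p)
    (hs : FreeGroup.lift f s.toFreeGroup p < p) :
    ¬ LGModelsLE.{u} LTerm.one (.sup (LTerm.join fun i => (t i).toLTerm) s.toLTerm) := by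
  rw [lgModelsLE_one_iff]
  intro h
  -- The refuting `ℓ`-group must live in universe `u`.
  let e : ℚ ≃o ULift.{u} ℚ := ULift.orderIso.symm
  let φ : X → (ULift.{u} ℚ ≃o ULift.{u} ℚ) := fun x => e.conjHom (f x)
  have hlift : FreeGroup.lift φ = e.conjHom.comp (FreeGroup.lift f) := by
    ext x : 1
    simp [φ]
  have heval : ∀ r : GroupTerm X, FreeGroup.lift f r.toFreeGroup p < p →
      r.toLTerm.eval φ (e p) < e p := by
    intro r hr
    rw [GroupTerm.eval_toLTerm, hlift, MonoidHom.comp_apply, OrderIso.conjHom_apply,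
      e.symm_apply_apply]
    exact e.lt_iff_lt.2 hr
  have hlt : (LTerm.sup (LTerm.join fun i => (t i).toLTerm) s.toLTerm).eval φ (e p) < e p :=
    max_lt (LTerm.eval_join_apply_lt φ (e p) _ fun i => heval _ (ht i)) (heval s hs)
  exact hlt.not_ge (h _ φ (e p))

theorem lgModelsLE_one_of_isEmpty {X : Type v} [IsEmpty X] {n : ℕ}
    (t : Fin (n + 1) → GroupTerm X) :
    LGModelsLE.{u} LTerm.one (LTerm.join fun i => (t i).toLTerm) := by
  rw [lgModelsLE_one_iff]
  intro L _ _ _ _ φ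
  have h := LTerm.eval_le_eval_join φ (fun i => (t i).toLTerm) 0
  rwa [GroupTerm.eval_toLTerm, Subsingleton.elim (t 0).toFreeGroup 1, map_one] at h

theorem lgModelsLE_one_sup_of_left {X : Type v} {a : LTerm X} (h : LGModelsLE.{u} LTerm.one a)
    (b : LTerm X) : LGModelsLE.{u} LTerm.one (.sup a b) := by
  rw [lgModelsLE_one_iff] at h ⊢
  intro L _ _ _ _ φ
  exact (h L φ).trans le_sup_left

theorem mainTheorem10 (k n : ℕ) (t : Fin (n + 1) → GroupTerm (Fin k)) :
    (LGModelsLE.{u} LTerm.one (LTerm.join fun i => (t i).toLTerm) →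
      ∀ s : GroupTerm (Fin k),
        LGModelsLE.{u} LTerm.one (.sup (LTerm.join fun i => (t i).toLTerm) s.toLTerm) ∨
        LGModelsLE.{u} LTerm.one (.sup (LTerm.join fun i => (t i).toLTerm) s.inv.toLTerm)) ∧
    (k ≠ 1 →
      (LGModelsLE.{u} LTerm.one (LTerm.join fun i => (t i).toLTerm) ↔
        ∀ s : GroupTerm (Fin k),
          LGModelsLE.{u} LTerm.one (.sup (LTerm.join fun i => (t i).toLTerm) s.toLTerm) ∨
          LGModelsLE.{u} LTerm.one
            (.sup (LTerm.join fun i => (t i).toLTerm) s.inv.toLTerm))) := by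
  have forward : LGModelsLE.{u} LTerm.one (LTerm.join fun i => (t i).toLTerm) →
      ∀ s : GroupTerm (Fin k),
        LGModelsLE.{u} LTerm.one (.sup (LTerm.join fun i => (t i).toLTerm) s.toLTerm) ∨
        LGModelsLE.{u} LTerm.one (.sup (LTerm.join fun i => (t i).toLTerm) s.inv.toLTerm) :=
    fun h _ => Or.inl (lgModelsLE_one_sup_of_left h _)
  refine ⟨forward, fun hk => ⟨forward, fun h => ?_⟩⟩
  rcases Nat.lt_or_ge k 2 with hk2 | hk2
  · obtain rfl : k = 0 := by omega
    exact lgModelsLE_one_of_isEmpty t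
  by_contra hnot
  have : Nontrivial (Fin k) := Fin.nontrivial_iff_two_le.2 hk2
  obtain ⟨f, p, hf⟩ := exists_rat_of_not_lgModelsLE t hnot
  obtain ⟨s, ⟨f₁, ht₁, hs₁⟩, ⟨f₂, ht₂, hs₂⟩⟩ :=
    exists_undetermined (fun i => (t i).toFreeGroup) f p hf
  obtain ⟨s, rfl⟩ := GroupTerm.toFreeGroup_surjective s
  rcases h s with h | h
  · exact not_lgModelsLE_sup_of_rat t s f₁ p ht₁ hs₁ h
  · exact not_lgModelsLE_sup_of_rat t s.inv f₂ p ht₂ hs₂ h
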